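/- Write $[n]=\{1,\dots,n\}$; for $J\subseteq[n]$ and $x\in\mathbb R^n$ let $x_J=(x_i)_{i\in J}$; $\|\cdot\|$ is the Euclidean norm and $e$ an all-ones vector. **Classes of polynomials.** A real polynomial, in any finite number of variables, is - *SDSOS* if it is a finite sum of polynomials $(a\,x^{\alpha}+b\,x^{\beta})^2$ with $a,b\in\mathbb R$ and exponent vectors $\alpha,\beta$; it is *DSOS* if in addition $a=b$ or $a=-b$ can be taken in every summand; - *SONC* if it is a finite sum of circuit polynomials that are non-negative everywhere; a circuit polynomial is $\sum_{\alpha\in A}c_\alpha x^\alpha-d\,x^\beta$ with all $c_\alpha>0$, $d\in\mathbb R$, $A$ a finite set of exponent vectors with even entries that is the vertex set of a simplex (of any dimension $\ge 0$), and $\beta$ an exponent vector in the relative interior of that simplex; - *SAGE* if it is a finite sum of AGE polynomials, i.e. of polynomials that are non-negative on the non-negative orthant and have at most one negative coefficient. **Sparsity.** Let $k\ge 1$ and $I=(I_1,\dots,I_k)$ be subsets of $[n]$ with $\bigcup_l I_l=[n]$ that satisfy the running intersection property: for every $1\le l\le k-1$ there is $j\le l$ with $\big(\bigcup_{\ell=1}^{l}I_\ell\big)\cap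 I_{l+1}\subseteq I_j$. Let $R\in\mathbb R^k$ have positive entries and put $\mathcal B^I_R=\{x\in\mathbb R^n:\|x_{I_l}\|\le R_l,\ l=1,\dots,k\}$. For $j=1,\dots,m$ let $l_j\in[k]$, let $g_j\in\mathbb R[x_{I_{l_j}}]$, and let $U_j>0$ satisfy $U_j\ge\max\{g_j(x_{I_{l_j}}):\|x_{I_{l_j}}\|\le R_{l_j}\}$. Let $p\in\mathbb R[x_1,\dots,x_n]$ be $I$-sparse, i.e. $p(x)=\sum_{l=1}^k p_l(x_{I_l})$ for some $p_l\in\mathbb R[x_{I_l}]$, and suppose $p>0$ on $\{x\in\mathcal B^I_R:\ g_j(x_{I_{l_j}})\ge 0,\ j=1,\dots,m\}$. **Corollary 4.2.** (i) For each of the four classes $\mathcal K\in\{\text{SONC},\text{SDSOS},\text{DSOS},\text{SAGE}\}$ there are polynomials $\alpha_{0,l}(y_{I_l},z_{I_l},u),\ \alpha_{1,l}(y_{I_l},z_{I_l},u)\in\mathcal K$ in $2|I_l|+1$ variables, $l=1,\dots,k$, and univariate polynomials $\rho_j(u)\in\mathcal K$, $j=1,\dots,m$, such that, as polynomials in $x$,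 $$p(x)=\sum_{l=1}^k\Big[\alpha_{0,l}\big(x_{I_l}+R_le,\,R_le-x_{I_l},\,R_l^2-\|x_{I_l}\|^2\big)+\alpha_{1,l}\big(x_{I_l}+R_le,\,R_le-x_{I_l},\,R_l^2-\|x_{I_l}\|^2\big)\,\big(R_l^2-\|x_{I_l}\|^2\big)\Big]+\sum_{j=1}^m\rho_j\big(U_j-g_j(x_{I_{l_j}})\big)\,g_j(x_{I_{l_j}}).$$ (ii) For SAGE there are SAGE polynomials $\alpha_l(y_{I_l},z_{I_l},u)$ in $2|I_l|+1$ variables, $l=1,\dots,k$, and univariate SAGE polynomials $\rho_j(u)$, $j=1,\dots,m$, such that, as polynomials in $x$, $$p(x)=\sum_{l=1}^k\alpha_l\big(x_{I_l}+R_le,\,R_le-x_{I_l},\,R_l^2-\|x_{I_l}\|^2\big)+\sum_{j=1}^m\rho_j\big(U_j-g_j(x_{I_{l_j}})\big)\,g_j(x_{I_{l_j}}).$$ -/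

import Mathlib

open MvPolynomial

namespace SparsePositivstellensatz

/-! ### Classes of polynomials

Each class is defined for real polynomials in an arbitrary family of variables `σ`. -/

/-- SDSOS polynomials: finite sums `∑ (a x^α + b x^β)²` of binomial squares. -/
def SDSOS (σ : Type) : Set (MvPolynomial σ ℝ) :=
  {p | ∃ (s : ℕ) (a b : Fin s → ℝ) (α β : Fin s → σ →₀ ℕ),
    p = ∑ l, (monomial (α l) (a l) + monomial (β l) (b l)) ^ 2}

/-- DSOS polynomials: finite sums `∑ (a x^α + b x^β)²` in which `b = a` or `b = -a`
in every summand. -/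
def DSOS (σ : Type) : Set (MvPolynomial σ ℝ) :=
  {p | ∃ (s : ℕ) (a b : Fin s → ℝ) (α β : Fin s → σ →₀ ℕ),
    (∀ l, a l = b l ∨ a l = -b l) ∧
    p = ∑ l, (monomial (α l) (a l) + monomial (β l) (b l)) ^ 2}

/-- An exponent vector, seen as a point of real affine space. -/
def expPoint {σ : Type} (a : σ →₀ ℕ) : σ → ℝ := fun i => (a i : ℝ)

/-- Circuit polynomials `∑_{α ∈ A} c_α x^α - d x^β`: all `c_α` are positive, `A` is a set of
exponents with even entries that is the vertex set of a simplex (of any dimension, possibly a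
single point), and `β` lies in the relative interior of that simplex. -/
def IsCircuit {σ : Type} (p : MvPolynomial σ ℝ) : Prop :=
  ∃ (A : Finset (σ →₀ ℕ)) (c : (σ →₀ ℕ) → ℝ) (β : σ →₀ ℕ) (d : ℝ),
    (∀ α ∈ A, 0 < c α) ∧
    (∀ α ∈ A, ∀ i, Even (α i)) ∧
    AffineIndependent ℝ (fun α : A => expPoint α.1) ∧
    expPoint β ∈ intrinsicInterior ℝ (convexHull ℝ (expPoint '' (A : Set (σ →₀ ℕ)))) ∧
    p = ∑ α ∈ A, monomial α (c α) - monomial β d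

/-- SONC polynomials: finite sums of circuit polynomials that are non-negative everywhere. -/
def SONC (σ : Type) : Set (MvPolynomial σ ℝ) :=
  {p | ∃ (s : ℕ) (q : Fin s → MvPolynomial σ ℝ),
    (∀ l, IsCircuit (q l) ∧ ∀ x : σ → ℝ, 0 ≤ eval x (q l)) ∧ p = ∑ l, q l}

/-- AGE polynomials: non-negative on the non-negative orthant, with at most one negative
coefficient. -/
def IsAGE {σ : Type} (q : MvPolynomial σ ℝ) : Prop :=
  (∀ x : σ → ℝ, (∀ i, 0 ≤ x i) → 0 ≤ eval x q) ∧ {a | coeff a q < 0}.Subsingleton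

/-- SAGE polynomials: finite sums of AGE polynomials. -/
def SAGE (σ : Type) : Set (MvPolynomial σ ℝ) :=
  {p | ∃ (s : ℕ) (q : Fin s → MvPolynomial σ ℝ), (∀ l, IsAGE (q l)) ∧ p = ∑ l, q l}

/-! ### Correlative sparsity -/

/-- `I` is a `k`-cover of the set of all indices. -/
def IsCover {n k : ℕ} (I : Fin k → Finset (Fin n)) : Prop :=
  Finset.univ.biUnion I = Finset.univ

/-- The running intersection property: every member after the first meets the union of its
predecessors inside a single predecessor. -/
def RIP {n k : ℕ} (I : Fin k → Finset (Fin n)) : Prop :=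
  ∀ t : Fin k, 0 < (t : ℕ) →
    ∃ j : Fin k, j < t ∧ (Finset.univ.filter (fun s : Fin k => s < t)).biUnion I ∩ I t ⊆ I j

/-- `x_J`, the coordinates of `x` with index in `J`, with the Euclidean norm. -/
noncomputable def restr {n : ℕ} (J : Finset (Fin n)) (x : Fin n → ℝ) : EuclideanSpace ℝ J :=
  WithLp.toLp 2 (fun i : J => x i)

/-- A polynomial in the variables `x_J`, read as a polynomial in all the variables. -/
noncomputable def extend {n : ℕ} (J : Finset (Fin n)) (q : MvPolynomial J ℝ) :
    MvPolynomial (Fin n) ℝ :=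
  rename Subtype.val q

/-- `p` is `I`-sparse: `p(x) = ∑_l p_l(x_{I_l})` for some polynomials `p_l`. -/
def IsSparse {n k : ℕ} (I : Fin k → Finset (Fin n)) (p : MvPolynomial (Fin n) ℝ) : Prop :=
  ∃ q : (l : Fin k) → MvPolynomial (I l) ℝ, p = ∑ l, extend (I l) (q l)

/-- The `I`-sparse ball of radius `R`. -/
def sparseBall {n k : ℕ} (I : Fin k → Finset (Fin n)) (R : Fin k → ℝ) : Set (Fin n → ℝ) :=
  {x | ∀ l, ‖restr (I l) x‖ ≤ R l}

/-- The polynomial `r² - ‖x_J‖²`. -/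
noncomputable def ballPoly {n : ℕ} (J : Finset (Fin n)) (r : ℝ) : MvPolynomial (Fin n) ℝ :=
  C (r ^ 2) - ∑ i ∈ J, X i ^ 2

/-- The polynomial `α(x_J + r e, r e - x_J, r² - ‖x_J‖²)`, where `α(y_J, z_J, u)` is a
polynomial in `2|J| + 1` variables. -/
noncomputable def substBall {n : ℕ} (J : Finset (Fin n)) (r : ℝ)
    (α : MvPolynomial (J ⊕ J ⊕ Unit) ℝ) : MvPolynomial (Fin n) ℝ :=
  aeval (Sum.elim (fun i : J => X i.1 + C r)
    (Sum.elim (fun i : J => C r - X i.1) (fun _ : Unit => ballPoly J r))) α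

/-- The polynomial `ρ(h(x))`, where `ρ` is a polynomial in one variable. -/
noncomputable def substUni {n : ℕ} (ρ : MvPolynomial Unit ℝ) (h : MvPolynomial (Fin n) ℝ) :
    MvPolynomial (Fin n) ℝ :=
  aeval (fun _ : Unit => h) ρ

end SparsePositivstellensatz

/-! All four classes contain the polynomials with non-negative coefficients and even exponents
(`evenPos`), so one representation with multipliers of this kind proves everything. It rests on
three reductions.

Penalty: since `g_j ≤ U_j` on the sparse ball, the term `(1 - g_j/U_j)^(2N) g_j` tends to 0 where
`g_j ≥ 0` and to `-∞` where `g_j < 0`. For large `N`, subtracting these terms from `p` leaves a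
polynomial positive on the whole sparse ball (`exists_pow_penalty`). Each term involves the
variables of a single `I_l`, so sparsity survives.

Gluing: by the running intersection property, a sparse polynomial positive on the sparse ball is a
sum of local ones, each positive on its own ball. Members are split off one at a time, moving a
polynomial in the shared variables from one summand to another (`exists_local_pos`).

Local representation: the preprime generated by `(x_i + r)²`, `(r - x_i)²` and `r² - ‖x‖²` is
archimedean, and its characters are the points of the ball. Krivine's theorem
(`mem_preprime_of_pos`) puts every polynomial positive on the ball into it. Its elements have the
form `a + b u` at `u = r² - ‖x‖²` with `a`, `b` in `evenPos`, because `u²` can be absorbed. -/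

namespace SparsePositivstellensatz

/-! ### Krivine's representation theorem for archimedean preprimes. -/

section Representation

variable {A : Type*} [CommRing A] [Algebra ℝ A]

/-- The states of `A` with respect to `T`: normalised linear functionals, nonnegative on `T`. -/
def states (T : Set A) : Set (A → ℝ) :=
  {L | (∀ a b, L (a + b) = L a + L b) ∧ (∀ (c : ℝ) a, L (c • a) = c * L a) ∧
    (∀ t ∈ T, 0 ≤ L t) ∧ L 1 = 1}

theorem states_isClosed (T : Set A) : IsClosed (states T) := by
  have h : states T = (⋂ a, ⋂ b, {L : A → ℝ | L (a + b) = L a + L b}) ∩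
      ((⋂ c : ℝ, ⋂ a, {L : A → ℝ | L (c • a) = c * L a}) ∩
      ((⋂ t ∈ T, {L : A → ℝ | 0 ≤ L t}) ∩ {L : A → ℝ | L 1 = 1})) := by
    ext L
    simp [states]
  rw [h]
  refine IsClosed.inter ?_ (IsClosed.inter ?_ (IsClosed.inter ?_ ?_))
  · exact isClosed_iInter fun a => isClosed_iInter fun b =>
      isClosed_eq (by fun_prop) (by fun_prop)
  · exact isClosed_iInter fun a => isClosed_iInter fun b =>
      isClosed_eq (by fun_prop) (by fun_prop)
  · exact isClosed_biInter fun t _ => isClosed_le (by fun_prop) (by fun_prop)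
  · exact isClosed_eq (by fun_prop) (by fun_prop)

/-- The archimedean property confines each value `L a` to `[-N (-a), N a]`, so Tychonoff applies. -/
theorem states_isCompact (T : Set A)
    (harch : ∀ a : A, ∃ N : ℝ, algebraMap ℝ A N - a ∈ T) : IsCompact (states T) := by
  choose N hN using harch
  refine IsCompact.of_isClosed_subset
    (isCompact_univ_pi fun a : A => isCompact_Icc (a := -N (-a)) (b := N a))
    (states_isClosed T) ?_
  rintro L ⟨hadd, hsmul, hpos, hone⟩ a -
  have hneg : ∀ a, L (-a) = -L a := fun a => by
    have := hsmul (-1) a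
    simpa using this
  have hle : ∀ a, L a ≤ N a := fun a => by
    have := hpos _ (hN a)
    rw [sub_eq_add_neg, hadd, hneg, Algebra.algebraMap_eq_smul_one, hsmul, hone] at this
    linarith
  exact ⟨by linarith [hle (-a), hneg a], hle a⟩

/-- An element outside an archimedean preprime is nonpositive at some state. -/
theorem exists_state_nonpos (T : Subsemiring A)
    (hT : ∀ c : ℝ, 0 ≤ c → algebraMap ℝ A c ∈ T)
    (harch : ∀ a : A, ∃ N : ℝ, algebraMap ℝ A N - a ∈ T) {f : A} (hf : f ∉ T) :
    ∃ L ∈ states (T : Set A), L f ≤ 0 := by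
  have hsm : ∀ c : ℝ, 0 ≤ c → ∀ t ∈ T, c • t ∈ T := fun c hc t ht => by
    rw [Algebra.smul_def]; exact T.mul_mem (hT c hc) ht
  -- Otherwise `f = (N + f) + |N| * (-1) + (|N| - N)` would lie in `T`.
  have hneg1 : (-1 : A) ∉ T := fun h => by
    obtain ⟨N, hN⟩ := harch (-f)
    have h2 := T.add_mem hN (T.mul_mem (hT |N| (abs_nonneg N)) h)
    have h3 := T.add_mem h2 (hT (|N| - N) (by linarith [le_abs_self N]))
    apply hf
    convert h3 using 1
    rw [map_sub]; ring
  have hone : (1 : A) ≠ 0 := fun h => hneg1 (by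
    rw [h, neg_zero]; exact T.zero_mem)
  -- The cone `T - ℝ≥0 f`: a functional non-negative on it is non-negative on `T` and non-positive
  -- at `f`.
  let C : PointedCone ℝ A :=
    { carrier := {a | ∃ t ∈ T, ∃ c : ℝ, 0 ≤ c ∧ a = t - c • f}
      add_mem' := by
        rintro _ _ ⟨t, ht, c, hc, rfl⟩ ⟨s, hs, d, hd, rfl⟩
        exact ⟨t + s, T.add_mem ht hs, c + d, add_nonneg hc hd, by rw [add_smul]; ring⟩
      zero_mem' := ⟨0, T.zero_mem, 0, le_rfl, by simp⟩
      smul_mem' := by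
        rintro ⟨r, hr⟩ _ ⟨t, ht, c, hc, rfl⟩
        refine ⟨r • t, hsm r hr t ht, r * c, mul_nonneg hr hc, ?_⟩
        change r • (t - c • f) = _
        rw [smul_sub, mul_smul] }
  have hTC : ∀ t ∈ T, t ∈ C := fun t ht => ⟨t, ht, 0, le_rfl, by simp⟩
  have hC : (-1 : A) ∉ C := by
    rintro ⟨t, ht, c, hc, h⟩
    rcases hc.eq_or_lt with rfl | hc
    · rw [zero_smul, sub_zero] at h
      exact hneg1 (h ▸ ht)
    · apply hf
      have : f = c⁻¹ • (t + 1) := by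
        rw [show t + 1 = c • f by linear_combination -h, smul_smul, inv_mul_cancel₀ hc.ne',
          one_smul]
      rw [this]
      exact hsm _ (inv_nonneg.2 hc.le) _ (T.add_mem ht T.one_mem)
  -- Extend `c • 1 ↦ c` from the line of constants. It is non-negative on `C` because `-1 ∉ C`, and
  -- the archimedean property supplies the cofinality that the extension needs.
  obtain ⟨L, hL1, hL2⟩ := riesz_extension C (LinearPMap.mkSpanSingleton (1 : A) (1 : ℝ) hone)
    (by
      rintro ⟨x, hx⟩ hxC
      obtain ⟨a, rfl⟩ := Submodule.mem_span_singleton.1 hx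
      rw [LinearPMap.mkSpanSingleton'_apply]
      by_contra hlt
      have ha : a < 0 := by simpa using hlt
      apply hC
      have := C.smul_mem (inv_nonneg.2 (neg_nonneg.2 ha.le)) hxC
      convert this using 1
      change _ = (-a)⁻¹ • (a • (1 : A))
      rw [smul_smul, show (-a)⁻¹ * a = -1 by rw [inv_neg, neg_mul, inv_mul_cancel₀ ha.ne], neg_one_smul])
    (by
      intro y
      obtain ⟨N, hN⟩ := harch (-y)
      refine ⟨⟨N • (1 : A), Submodule.mem_span_singleton.2 ⟨N, rfl⟩⟩, hTC _ ?_⟩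
      rw [Algebra.algebraMap_eq_smul_one, sub_neg_eq_add] at hN
      exact hN)
  refine ⟨L, ⟨fun a b => L.map_add a b, fun c a => by simp, fun t ht => hL2 t (hTC t ht), ?_⟩, ?_⟩
  · have := hL1 ⟨(1 : ℝ) • (1 : A), Submodule.mem_span_singleton.2 ⟨1, rfl⟩⟩
    erw [LinearPMap.mkSpanSingleton'_apply] at this
    simpa using this
  · have := hL2 (-f) ⟨0, T.zero_mem, 1, zero_le_one, by simp⟩
    rw [map_neg] at this
    linarith

theorem eq_and_eq_of_convex_combination {p q u v m : ℝ} (hp : 0 < p) (hq : 0 < q)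
    (hpq : p + q = 1) (hu : m ≤ u) (hv : m ≤ v) (h : m = p * u + q * v) : u = m ∧ v = m := by
  have h1 := mul_nonneg hp.le (sub_nonneg.2 hu)
  have h2 := mul_nonneg hq.le (sub_nonneg.2 hv)
  have h3 : p * (u - m) + q * (v - m) = 0 := by linear_combination -h - m * hpq
  have h4 : p * (u - m) = 0 := by linarith
  have h5 : q * (v - m) = 0 := by linarith
  exact ⟨by simpa [hp.ne', sub_eq_zero] using h4, by simpa [hq.ne', sub_eq_zero] using h5⟩

/-- If a state is an extreme point of a face cut out by minimising the value at `f`, then it is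
multiplicative. -/
theorem state_mul_of_extreme (T : Subsemiring A)
    (hT : ∀ c : ℝ, 0 ≤ c → algebraMap ℝ A c ∈ T)
    (harch : ∀ a : A, ∃ N : ℝ, algebraMap ℝ A N - a ∈ T) {f : A} {m : ℝ}
    (hm : ∀ L ∈ states (T : Set A), m ≤ L f) {L : A → ℝ}
    (hL : L ∈ (states (T : Set A) ∩ {L | L f = m}).extremePoints ℝ) (a b : A) :
    L (a * b) = L a * L b := by
  obtain ⟨⟨⟨hadd, hsmul, hpos, hone⟩, hLf⟩, hext⟩ := hL
  have hsub : ∀ a b, L (a - b) = L a - L b := fun a b => by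
    have := hadd (a - b) b
    rw [sub_add_cancel] at this
    linarith
  have hc : ∀ c : ℝ, L (algebraMap ℝ A c) = c := fun c => by
    rw [Algebra.algebraMap_eq_smul_one, hsmul, hone, mul_one]
  have htwist : ∀ t ∈ T, 0 < L t → (fun x => (L t)⁻¹ * L (t * x)) ∈ states (T : Set A) := by
    intro t ht hLt
    refine ⟨fun x y => ?_, fun c x => ?_, fun s hs => ?_, ?_⟩
    · simp only [mul_add, hadd]
    · simp only [mul_smul_comm, hsmul]; ring
    · exact mul_nonneg (inv_nonneg.2 hLt.le) (hpos _ (T.mul_mem ht hs))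
    · simp [hLt.ne']
  have key : ∀ t ∈ T, 0 < L t → L (t * b) = L t * L b := by
    intro t ht hLt
    obtain ⟨N, hN⟩ := harch t
    -- `N + 1` in place of `N` makes `L s ≥ 1`, so that twisting by `s` is defined as well.
    have hs : algebraMap ℝ A (N + 1) - t ∈ T := by
      have := T.add_mem hN (hT 1 zero_le_one)
      convert this using 1
      rw [map_add]; ring
    have hNt : 0 ≤ N - L t := by
      have := hpos _ hN
      rwa [hsub, hc] at this
    set s := algebraMap ℝ A (N + 1) - t with hsdef
    have hLs : L s = N + 1 - L t := by rw [hsdef, hsub, hc]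
    have hLs0 : 0 < L s := by linarith
    have h1 := htwist t ht hLt
    have h2 := htwist s hs hLs0
    have hN0 : 0 < N + 1 := by linarith
    -- As `t + s = N + 1`, the state `L` is a convex combination of its twists by `t` and `s`.
    -- Minimality of `m` forces both into the face, and extremality then makes them equal to `L`.
    have hcomb : ∀ x, L x = (L t / (N + 1)) * ((L t)⁻¹ * L (t * x)) +
        (L s / (N + 1)) * ((L s)⁻¹ * L (s * x)) := by
      intro x
      have : L (s * x) = (N + 1) * L x - L (t * x) := by
        rw [hsdef, sub_mul, hsub, ← Algebra.smul_def, hsmul]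
      rw [this]
      field_simp
      ring
    have hp1 : 0 < L t / (N + 1) := by positivity
    have hp2 : 0 < L s / (N + 1) := by positivity
    have hp : L t / (N + 1) + L s / (N + 1) = 1 := by
      rw [hLs]; field_simp; ring
    have hm1 := hm _ h1
    have hm2 := hm _ h2
    have hf := hcomb f
    change m ≤ (L t)⁻¹ * L (t * f) at hm1
    change m ≤ (L s)⁻¹ * L (s * f) at hm2
    have hLf' : L f = m := hLf
    rw [hLf'] at hf
    obtain ⟨e1, e2⟩ := eq_and_eq_of_convex_combination hp1 hp2 hp hm1 hm2 hf
    have := hext ⟨h1, e1⟩ ⟨h2, e2⟩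
      ⟨_, _, hp1, hp2, hp, by ext x; simpa using (hcomb x).symm⟩
    have : (L t)⁻¹ * L (t * b) = L b := congrFun this b
    field_simp at this
    linarith
  -- Adding the constant `1 + N` moves an arbitrary `a` into `T` with positive value; the constant
  -- cancels by linearity.
  obtain ⟨N, hN⟩ := harch (-a)
  have ht : algebraMap ℝ A ((1 : ℝ) + N) + a ∈ T := by
    have := T.add_mem hN (hT 1 zero_le_one)
    convert this using 1
    rw [map_add (algebraMap ℝ A) _ N]; ring
  have hN0 : 0 ≤ N + L a := by
    have := hpos _ hN
    rwa [sub_neg_eq_add, hadd, hc] at this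
  have := key _ ht (by rw [hadd, hc]; linarith)
  rw [add_mul, hadd, ← Algebra.smul_def, hsmul, hadd, hc] at this
  linarith

/-- **Krivine's representation theorem**: an element of a commutative `ℝ`-algebra that is positive
at every character nonnegative on an archimedean preprime belongs to the preprime. -/
theorem mem_preprime_of_pos (T : Subsemiring A)
    (hT : ∀ c : ℝ, 0 ≤ c → algebraMap ℝ A c ∈ T)
    (harch : ∀ a : A, ∃ N : ℝ, algebraMap ℝ A N - a ∈ T) {f : A}
    (hf : ∀ φ : A →ₐ[ℝ] ℝ, (∀ t ∈ T, 0 ≤ φ t) → 0 < φ f) : f ∈ T := by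
  by_contra hfT
  obtain ⟨L₀, hL₀, hL₀f⟩ := exists_state_nonpos T hT harch hfT
  have hcomp := states_isCompact (T : Set A) harch
  obtain ⟨M, hM, hMmin⟩ := hcomp.exists_isMinOn ⟨L₀, hL₀⟩
    (continuous_apply f).continuousOn
  have hmin : ∀ L ∈ states (T : Set A), M f ≤ L f := fun L hL => hMmin hL
  have hface : IsCompact (states (T : Set A) ∩ {L | L f = M f}) :=
    hcomp.inter_right (isClosed_eq (by fun_prop) (by fun_prop))
  -- Krein–Milman on the face of states minimising the value at `f`.
  obtain ⟨L, hL⟩ := hface.extremePoints_nonempty ⟨M, hM, rfl⟩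
  have hmul := state_mul_of_extreme T hT harch hmin hL
  obtain ⟨⟨⟨hadd, hsmul, hpos, hone⟩, hLf⟩, -⟩ := hL
  let φ : A →ₐ[ℝ] ℝ := AlgHom.ofLinearMap
    { toFun := L, map_add' := hadd, map_smul' := fun c a => by simpa using hsmul c a } hone hmul
  have h1 : 0 < L f := hf φ hpos
  have h2 : L f = M f := hLf
  have h3 := hmin L₀ hL₀
  linarith

end Representation

/-! ### Even polynomials with non-negative coefficients inside the four classes. -/

section EvenPositive

/-- Polynomials with nonnegative coefficients and only even exponents. -/
def evenPos (σ : Type) : Subsemiring (MvPolynomial σ ℝ) where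
  carrier := {p | ∀ a, 0 ≤ coeff a p ∧ (coeff a p ≠ 0 → ∀ i, Even (a i))}
  zero_mem' := by simp
  one_mem' := by
    classical
    intro a
    rw [coeff_one]
    split_ifs with h
    · subst h; simp
    · simp
  add_mem' := by
    intro p q hp hq a
    rw [coeff_add]
    refine ⟨add_nonneg (hp a).1 (hq a).1, fun h => ?_⟩
    by_cases h0 : coeff a p = 0
    · exact (hq a).2 (by simpa [h0] using h)
    · exact (hp a).2 h0
  mul_mem' := by
    classical
    intro p q hp hq a
    rw [coeff_mul]
    refine ⟨Finset.sum_nonneg fun x _ => mul_nonneg (hp _).1 (hq _).1, fun h i => ?_⟩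
    obtain ⟨x, hx, hne⟩ := Finset.exists_ne_zero_of_sum_ne_zero h
    rw [← Finset.HasAntidiagonal.mem_antidiagonal.1 hx, Finsupp.add_apply]
    exact ((hp _).2 (left_ne_zero_of_mul hne) i).add ((hq _).2 (right_ne_zero_of_mul hne) i)

variable {σ : Type}

theorem C_mem_evenPos {c : ℝ} (hc : 0 ≤ c) : (C c : MvPolynomial σ ℝ) ∈ evenPos σ := by
  classical
  intro a
  rw [coeff_C]
  split_ifs with h
  · subst h; simp [hc]
  · simp

theorem X_pow_mem_evenPos (i : σ) (N : ℕ) : (X i ^ (2 * N) : MvPolynomial σ ℝ) ∈ evenPos σ := by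
  classical
  intro a
  rw [coeff_X_pow]
  split_ifs with h
  · subst h
    refine ⟨zero_le_one, fun _ j => ?_⟩
    rw [Finsupp.single_apply]
    split_ifs <;> simp
  · simp

theorem X_sq_mem_evenPos (i : σ) : (X i ^ 2 : MvPolynomial σ ℝ) ∈ evenPos σ :=
  X_pow_mem_evenPos i 1

theorem exists_eq_sum_of_mem_evenPos {p : MvPolynomial σ ℝ} (hp : p ∈ evenPos σ) :
    ∃ (s : ℕ) (c : Fin s → ℝ) (α : Fin s → σ →₀ ℕ), (∀ l, 0 < c l) ∧
      p = ∑ l, monomial (α l + α l) (c l) := by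
  classical
  let e := p.support.equivFin
  have h0 : ∀ a ∈ p.support, coeff a p ≠ 0 := fun a ha => mem_support_iff.1 ha
  refine ⟨p.support.card, fun l => coeff (e.symm l).1 p,
    fun l => (e.symm l).1.mapRange (· / 2) (Nat.zero_div 2), fun l => ?_, ?_⟩
  · exact lt_of_le_of_ne (hp _).1 (h0 _ (e.symm l).2).symm
  · have h1 : ∀ l, monomial ((e.symm l).1.mapRange (· / 2) (Nat.zero_div 2) +
        (e.symm l).1.mapRange (· / 2) (Nat.zero_div 2)) (coeff (e.symm l).1 p) =
        monomial (e.symm l).1 (coeff (e.symm l).1 p) := by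
      intro l
      refine congrArg (fun a => monomial a _) (Finsupp.ext fun i => ?_)
      have := (hp _).2 (h0 _ (e.symm l).2) i
      rw [Finsupp.add_apply, Finsupp.mapRange_apply]
      obtain ⟨t, ht⟩ := this
      omega
    rw [Finset.sum_congr rfl fun l _ => h1 l,
      e.symm.sum_comp (fun a : p.support => monomial a.1 (coeff a.1 p)),
      Finset.sum_coe_sort p.support (fun a => monomial a (coeff a p))]
    exact p.as_sum

theorem evenPos_subset_DSOS : (evenPos σ : Set (MvPolynomial σ ℝ)) ⊆ DSOS σ := by
  intro p hp
  obtain ⟨s, c, α, hc, rfl⟩ := exists_eq_sum_of_mem_evenPos hp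
  refine ⟨s, fun l => √(c l) / 2, fun l => √(c l) / 2, α, α, fun l => Or.inl rfl, ?_⟩
  refine Finset.sum_congr rfl fun l _ => ?_
  rw [← map_add, add_halves, sq, monomial_mul, Real.mul_self_sqrt (hc l).le]

theorem DSOS_subset_SDSOS : DSOS σ ⊆ SDSOS σ := by
  rintro p ⟨s, a, b, α, β, -, h⟩
  exact ⟨s, a, b, α, β, h⟩

theorem isCircuit_monomial (α : σ →₀ ℕ) {c : ℝ} (hc : 0 < c) :
    IsCircuit (monomial (α + α) c : MvPolynomial σ ℝ) := by
  refine ⟨{α + α}, fun _ => c, α + α, 0, fun _ _ => hc, ?_, ?_, ?_, ?_⟩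
  · intro a ha i
    rw [Finset.mem_singleton.1 ha, Finsupp.add_apply]
    exact ⟨_, rfl⟩
  · exact affineIndependent_of_subsingleton ℝ _
  · simp
  · simp

theorem eval_monomial_add_self_nonneg (α : σ →₀ ℕ) {c : ℝ} (hc : 0 ≤ c) (x : σ → ℝ) :
    0 ≤ eval x (monomial (α + α) c : MvPolynomial σ ℝ) := by
  rw [eval_monomial]
  refine mul_nonneg hc (Finset.prod_nonneg fun i _ => ?_)
  rw [Finsupp.add_apply]
  exact Even.pow_nonneg ⟨_, rfl⟩ _

theorem evenPos_subset_SONC : (evenPos σ : Set (MvPolynomial σ ℝ)) ⊆ SONC σ := by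
  intro p hp
  obtain ⟨s, c, α, hc, rfl⟩ := exists_eq_sum_of_mem_evenPos hp
  exact ⟨s, fun l => monomial (α l + α l) (c l), fun l =>
    ⟨isCircuit_monomial _ (hc l), eval_monomial_add_self_nonneg _ (hc l).le⟩, rfl⟩

theorem mem_SAGE_of_coeff_nonneg {p : MvPolynomial σ ℝ} (hp : ∀ a, 0 ≤ coeff a p) :
    p ∈ SAGE σ := by
  refine ⟨1, fun _ => p, fun _ => ⟨fun x hx => ?_, fun a ha => ?_⟩, by simp⟩
  · rw [eval_eq]
    exact Finset.sum_nonneg fun a _ => mul_nonneg (hp a)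
      (Finset.prod_nonneg fun i _ => pow_nonneg (hx i) _)
  · exact absurd (hp a) (not_le.2 ha)

theorem evenPos_subset_SAGE : (evenPos σ : Set (MvPolynomial σ ℝ)) ⊆ SAGE σ :=
  fun _ hp => mem_SAGE_of_coeff_nonneg fun a => (hp a).1

/-- Non-negative coefficients alone suffice for SAGE, whatever the parity of the exponents. The odd
factor `u` can therefore be absorbed, which yields the shorter representation. -/
theorem add_X_mul_mem_SAGE {p q : MvPolynomial σ ℝ} (hp : p ∈ evenPos σ) (hq : q ∈ evenPos σ)
    (i : σ) : p + q * X i ∈ SAGE σ := by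
  classical
  refine mem_SAGE_of_coeff_nonneg fun a => ?_
  rw [coeff_add, coeff_mul_X']
  refine add_nonneg (hp a).1 ?_
  split_ifs
  · exact (hq _).1
  · exact le_rfl

end EvenPositive

/-! ### The archimedean preprime of a ball. -/

section Ball

variable {τ : Type} [Fintype τ]

/-- The substitution `α(y, z, u) ↦ α(x + r e, r e - x, r² - ‖x‖²)`. -/
noncomputable def ballSubst (r : ℝ) :
    MvPolynomial (τ ⊕ τ ⊕ Unit) ℝ →ₐ[ℝ] MvPolynomial τ ℝ :=
  aeval (Sum.elim (fun i => X i + C r)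
    (Sum.elim (fun i => C r - X i) (fun _ => C (r ^ 2) - ∑ i, X i ^ 2)))

/-- The preprime generated by `(x_i + r)²`, `(r - x_i)²` and `r² - ‖x‖²`. -/
noncomputable def ballPreprime (τ : Type) [Fintype τ] (r : ℝ) :
    Subsemiring (MvPolynomial τ ℝ) where
  carrier := {q | ∃ a ∈ evenPos (τ ⊕ τ ⊕ Unit), ∃ b ∈ evenPos (τ ⊕ τ ⊕ Unit),
    q = ballSubst r (a + b * X (Sum.inr (Sum.inr ())))}
  zero_mem' := ⟨0, zero_mem _, 0, zero_mem _, by simp⟩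
  one_mem' := ⟨1, one_mem _, 0, zero_mem _, by simp⟩
  add_mem' := by
    rintro _ _ ⟨a, ha, b, hb, rfl⟩ ⟨c, hc, d, hd, rfl⟩
    refine ⟨a + c, add_mem ha hc, b + d, add_mem hb hd, ?_⟩
    rw [← map_add]; congr 1; ring
  mul_mem' := by
    rintro _ _ ⟨a, ha, b, hb, rfl⟩ ⟨c, hc, d, hd, rfl⟩
    -- The product of the two odd parts carries `u²`, an even monomial, and so joins the even part.
    refine ⟨a * c + b * d * X (Sum.inr (Sum.inr ())) ^ 2,
      add_mem (mul_mem ha hc) (mul_mem (mul_mem hb hd) (X_sq_mem_evenPos _)),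
      a * d + b * c, add_mem (mul_mem ha hd) (mul_mem hb hc), ?_⟩
    rw [← map_mul]; congr 1; ring

theorem ballSubst_mem_ballPreprime (r : ℝ) {a : MvPolynomial (τ ⊕ τ ⊕ Unit) ℝ}
    (ha : a ∈ evenPos (τ ⊕ τ ⊕ Unit)) : ballSubst r a ∈ ballPreprime τ r :=
  ⟨a, ha, 0, zero_mem _, by simp⟩

theorem C_mem_ballPreprime (r : ℝ) {c : ℝ} (hc : 0 ≤ c) :
    (C c : MvPolynomial τ ℝ) ∈ ballPreprime τ r := by
  simpa [ballSubst] using ballSubst_mem_ballPreprime (τ := τ) r (C_mem_evenPos hc)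

theorem add_sq_mem_ballPreprime (r : ℝ) (i : τ) : (X i + C r) ^ 2 ∈ ballPreprime τ r := by
  simpa [ballSubst] using ballSubst_mem_ballPreprime (τ := τ) r (X_sq_mem_evenPos (Sum.inl i))

theorem sub_sq_mem_ballPreprime (r : ℝ) (i : τ) : (C r - X i) ^ 2 ∈ ballPreprime τ r := by
  simpa [ballSubst] using
    ballSubst_mem_ballPreprime (τ := τ) r (X_sq_mem_evenPos (Sum.inr (Sum.inl i)))

theorem ball_mem_ballPreprime (r : ℝ) :
    C (r ^ 2) - ∑ i, X i ^ 2 ∈ ballPreprime τ r :=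
  ⟨0, zero_mem _, 1, one_mem _, by simp [ballSubst]⟩

/-- The subalgebra of elements bounded with respect to a preprime. -/
def boundedSubalgebra {A : Type*} [CommRing A] [Algebra ℝ A] (T : Subsemiring A)
    (hT : ∀ c : ℝ, 0 ≤ c → algebraMap ℝ A c ∈ T) : Subalgebra ℝ A where
  carrier := {a | ∃ N : ℝ, 0 ≤ N ∧ algebraMap ℝ A N - a ∈ T ∧ algebraMap ℝ A N + a ∈ T}
  algebraMap_mem' c := by
    refine ⟨|c|, abs_nonneg c, ?_, ?_⟩
    · rw [← map_sub]; exact hT _ (by linarith [le_abs_self c])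
    · rw [← map_add]; exact hT _ (by linarith [neg_abs_le c])
  add_mem' := by
    rintro a b ⟨N, hN, h1, h2⟩ ⟨M, hM, h3, h4⟩
    refine ⟨N + M, add_nonneg hN hM, ?_, ?_⟩
    · convert T.add_mem h1 h3 using 1
      rw [map_add]; ring
    · convert T.add_mem h2 h4 using 1
      rw [map_add]; ring
  mul_mem' := by
    rintro a b ⟨N, hN, h1, h2⟩ ⟨M, hM, h3, h4⟩
    have hhalf : algebraMap ℝ A (1 / 2) * 2 = 1 := by
      rw [show (2 : A) = algebraMap ℝ A 2 from (map_ofNat _ 2).symm, ← map_mul]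
      norm_num
    refine ⟨N * M, mul_nonneg hN hM, ?_, ?_⟩
    -- `NM - ab = ½ ((N - a)(M + b) + (N + a)(M - b))`; the other sign is similar.
    · convert T.mul_mem (hT (1 / 2) (by norm_num))
        (T.add_mem (T.mul_mem h1 h4) (T.mul_mem h2 h3)) using 1
      rw [map_mul]
      linear_combination (-(algebraMap ℝ A N * algebraMap ℝ A M - a * b)) * hhalf
    · convert T.mul_mem (hT (1 / 2) (by norm_num))
        (T.add_mem (T.mul_mem h2 h4) (T.mul_mem h1 h3)) using 1
      rw [map_mul]
      linear_combination (-(algebraMap ℝ A N * algebraMap ℝ A M + a * b)) * hhalf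

/-- For `j ≠ i` the average of the two squares is `x_j² + r²`, while `(x_i + r)²` contributes the
extra `2 r x_i`. Adding `r² - ‖x‖²` cancels all the squares. -/
theorem const_add_mem_ballPreprime [DecidableEq τ] (r : ℝ) (i : τ) :
    C (((Fintype.card τ : ℝ) + 1) * r ^ 2) + C (2 * r) * X i ∈ ballPreprime τ r := by
  have h : ∀ j ∈ Finset.univ,
      (if j = i then (X i + C r) ^ 2 else C (1 / 2) * ((X j + C r) ^ 2 + (C r - X j) ^ 2)) ∈
        ballPreprime τ r := by
    intro j _
    split_ifs
    · exact add_sq_mem_ballPreprime r i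
    · exact mul_mem (C_mem_ballPreprime r (by norm_num))
        (add_mem (add_sq_mem_ballPreprime r j) (sub_sq_mem_ballPreprime r j))
  convert add_mem (sum_mem h) (ball_mem_ballPreprime (τ := τ) r) using 1
  have h2 : ∀ j, (if j = i then (X i + C r) ^ 2
      else C (1 / 2) * ((X j + C r) ^ 2 + (C r - X j) ^ 2) : MvPolynomial τ ℝ) =
      X j ^ 2 + C (r ^ 2) + if j = i then C (2 * r) * X i else 0 := by
    intro j
    split_ifs with hj
    · subst hj
      simp only [map_pow, map_mul, map_ofNat]; ring
    · have : (C (1 / 2) : MvPolynomial τ ℝ) * 2 = 1 := by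
        rw [show (2 : MvPolynomial τ ℝ) = C 2 from (map_ofNat _ 2).symm, ← map_mul]
        norm_num
      rw [map_pow]
      linear_combination (X j ^ 2 + C r ^ 2) * this
  simp only [h2, Finset.sum_add_distrib, Finset.sum_ite_eq', Finset.mem_univ, if_true,
    Finset.sum_const, Finset.card_univ, nsmul_eq_mul]
  simp only [map_mul, map_add, map_natCast, map_one, map_pow]
  ring

theorem const_sub_mem_ballPreprime [DecidableEq τ] (r : ℝ) (i : τ) :
    C (((Fintype.card τ : ℝ) + 1) * r ^ 2) - C (2 * r) * X i ∈ ballPreprime τ r := by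
  have h : ∀ j ∈ Finset.univ,
      (if j = i then (C r - X i) ^ 2 else C (1 / 2) * ((X j + C r) ^ 2 + (C r - X j) ^ 2)) ∈
        ballPreprime τ r := by
    intro j _
    split_ifs
    · exact sub_sq_mem_ballPreprime r i
    · exact mul_mem (C_mem_ballPreprime r (by norm_num))
        (add_mem (add_sq_mem_ballPreprime r j) (sub_sq_mem_ballPreprime r j))
  convert add_mem (sum_mem h) (ball_mem_ballPreprime (τ := τ) r) using 1
  have h2 : ∀ j, (if j = i then (C r - X i) ^ 2
      else C (1 / 2) * ((X j + C r) ^ 2 + (C r - X j) ^ 2) : MvPolynomial τ ℝ) =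
      X j ^ 2 + C (r ^ 2) - if j = i then C (2 * r) * X i else 0 := by
    intro j
    split_ifs with hj
    · subst hj
      simp only [map_pow, map_mul, map_ofNat]; ring
    · have : (C (1 / 2) : MvPolynomial τ ℝ) * 2 = 1 := by
        rw [show (2 : MvPolynomial τ ℝ) = C 2 from (map_ofNat _ 2).symm, ← map_mul]
        norm_num
      rw [map_pow]
      linear_combination (X j ^ 2 + C r ^ 2) * this
  simp only [h2, Finset.sum_add_distrib, Finset.sum_sub_distrib, Finset.sum_ite_eq',
    Finset.mem_univ, if_true, Finset.sum_const, Finset.card_univ, nsmul_eq_mul]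
  simp only [map_mul, map_add, map_natCast, map_one, map_pow]
  ring

/-- The bounded elements form a subalgebra, so it is enough to bound the variables. -/
theorem ballPreprime_archimedean {r : ℝ} (hr : 0 < r) (a : MvPolynomial τ ℝ) :
    ∃ N : ℝ, algebraMap ℝ (MvPolynomial τ ℝ) N - a ∈ ballPreprime τ r := by
  classical
  have hmem : a ∈ boundedSubalgebra (ballPreprime τ r)
      (fun c hc => C_mem_ballPreprime r hc) := by
    induction a using MvPolynomial.induction_on with
    | C c => exact Subalgebra.algebraMap_mem _ c
    | add p q hp hq => exact add_mem hp hq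
    | mul_X p i hp =>
      refine mul_mem hp ?_
      have hinv : (C (1 / (2 * r)) : MvPolynomial τ ℝ) * C (2 * r) = 1 := by
        rw [← map_mul, one_div_mul_cancel (by positivity), map_one]
      have hnn : 0 ≤ 1 / (2 * r) := by positivity
      refine ⟨1 / (2 * r) * (((Fintype.card τ : ℝ) + 1) * r ^ 2), by positivity, ?_, ?_⟩
      · convert mul_mem (C_mem_ballPreprime r hnn) (const_sub_mem_ballPreprime r i) using 1
        rw [MvPolynomial.algebraMap_eq, map_mul C]
        linear_combination X i * hinv
      · convert mul_mem (C_mem_ballPreprime r hnn) (const_add_mem_ballPreprime r i) using 1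
        rw [MvPolynomial.algebraMap_eq, map_mul C]
        linear_combination -X i * hinv
  obtain ⟨N, -, h, -⟩ := hmem
  exact ⟨N, h⟩

/-- A polynomial positive on a ball of radius `r` lies in the preprime generated by `(x_i + r)²`,
`(r - x_i)²` and `r² - ‖x‖²`. -/
theorem mem_ballPreprime_of_pos {r : ℝ} (hr : 0 < r) {q : MvPolynomial τ ℝ}
    (hq : ∀ x : τ → ℝ, ∑ i, x i ^ 2 ≤ r ^ 2 → 0 < eval x q) : q ∈ ballPreprime τ r := by
  refine mem_preprime_of_pos _ (fun c hc => C_mem_ballPreprime r hc)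
    (ballPreprime_archimedean hr) fun φ hφ => ?_
  -- A character of a polynomial ring is evaluation at a point; its sign on `r² - ‖x‖²` puts the
  -- point in the ball.
  have hev : ∀ p, φ p = eval (fun i => φ (X i)) p := fun p => by
    have : φ = aeval (fun i => φ (X i)) := algHom_ext (by simp)
    conv_lhs => rw [this]
    rfl
  rw [hev]
  apply hq
  have := hφ _ (ball_mem_ballPreprime r)
  rw [hev] at this
  simpa using this

theorem substBall_eq {n : ℕ} (J : Finset (Fin n)) (r : ℝ) (α : MvPolynomial (J ⊕ J ⊕ Unit) ℝ) :
    substBall J r α = extend J (ballSubst r α) := by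
  have : (rename (R := ℝ) (Subtype.val : J → Fin n)).comp (ballSubst r) =
      aeval (Sum.elim (fun i : J => X i.1 + C r)
        (Sum.elim (fun i : J => C r - X i.1) (fun _ : Unit => ballPoly J r))) := by
    refine algHom_ext fun i => ?_
    rcases i with i | i | i
    · simp [ballSubst]
    · simp [ballSubst]
    · simp [ballSubst, ballPoly, Finset.sum_attach J (fun i => (X i : MvPolynomial _ ℝ) ^ 2)]
  exact (DFunLike.congr_fun this α).symm

theorem substBall_add_mul_X {n : ℕ} (J : Finset (Fin n)) (r : ℝ)
    (a b : MvPolynomial (J ⊕ J ⊕ Unit) ℝ) :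
    substBall J r (a + b * X (Sum.inr (Sum.inr ()))) =
      substBall J r a + substBall J r b * ballPoly J r := by
  simp [substBall]

end Ball

/-! ### Splitting a sparse positive polynomial into local positive summands. -/

section Gluing

theorem exists_mvPolynomial_near {ι : Type*} {S : Set (ι → ℝ)} (hS : IsCompact S)
    {φ : (ι → ℝ) → ℝ} (hφ : Continuous φ) {ε : ℝ} (hε : 0 < ε) :
    ∃ P : MvPolynomial ι ℝ, ∀ z ∈ S, |eval z P - φ z| < ε := by
  have : CompactSpace S := isCompact_iff_compactSpace.1 hS
  let coord : ι → C(S, ℝ) := fun i => ⟨fun z => z.1 i, (continuous_apply i).comp continuous_subtype_val⟩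
  have hsep : (aeval (R := ℝ) coord).range.SeparatesPoints := by
    intro z w hzw
    obtain ⟨i, hi⟩ := Function.ne_iff.1 (fun h => hzw (Subtype.ext h))
    exact ⟨coord i, ⟨coord i, ⟨X i, by simp⟩, rfl⟩, hi⟩
  obtain ⟨⟨_, P, rfl⟩, hP⟩ :=
    ContinuousMap.exists_mem_subalgebra_near_continuous_of_separatesPoints _ hsep
      (fun z : S => φ z.1) (by fun_prop) ε hε
  refine ⟨P, fun z hz => ?_⟩
  have hev : (ContinuousMap.evalAlgHom ℝ ℝ (⟨z, hz⟩ : S)).comp (aeval coord) = aeval z :=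
    algHom_ext fun i => by simp [coord]
  have := hP ⟨z, hz⟩
  rw [Real.norm_eq_abs] at this
  convert this using 3
  exact (DFunLike.congr_fun hev P).symm

theorem exists_between_of_isCompact {S T : Set ℝ} (hS : IsCompact S) (hT : IsCompact T)
    (h : ∀ s ∈ S, ∀ t ∈ T, s < t) : ∃ c, (∀ s ∈ S, s < c) ∧ ∀ t ∈ T, c < t := by
  rcases S.eq_empty_or_nonempty with rfl | hSne
  · obtain ⟨c, hc⟩ := hT.bddBelow
    exact ⟨c - 1, by simp, fun t ht => by linarith [hc ht]⟩
  · obtain ⟨a, ha, hamax⟩ := hS.exists_isGreatest hSne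
    obtain ⟨c, hac, hc⟩ := hT.exists_forall_le' continuousOn_id (fun t ht => h a ha t ht)
    exact ⟨(a + c) / 2, fun s hs => by linarith [hamax hs],
      fun t ht => by have : c ≤ t := hc t ht; linarith⟩

variable {E : Type*} [TopologicalSpace E]

/-- Two continuous functions on compact sets whose sum is positive on the fibre product over a
coordinate space can be separated by a polynomial in these coordinates. -/
theorem exists_mvPolynomial_separating {ι : Type*} [Fintype ι] {π : E → ι → ℝ}
    (hπ : Continuous π) {K₁ K₂ : Set E} (hK₁ : IsCompact K₁) (hK₂ : IsCompact K₂) {f₁ f₂ : E → ℝ}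
    (hf₁ : Continuous f₁) (hf₂ : Continuous f₂)
    (h : ∀ x ∈ K₁, ∀ y ∈ K₂, π x = π y → 0 < f₁ x + f₂ y) :
    ∃ P : MvPolynomial ι ℝ, (∀ x ∈ K₁, 0 < f₁ x + eval (π x) P) ∧
      ∀ y ∈ K₂, 0 < f₂ y - eval (π y) P := by
  -- The admissible values at `z` of the separating function form a convex set. A value admissible
  -- at `z` stays admissible nearby (`hopen`), so a partition of unity gives a continuous selection.
  let t : (ι → ℝ) → Set ℝ := fun z =>
    {c | (∀ x ∈ K₁, π x = z → 0 < f₁ x + c) ∧ ∀ y ∈ K₂, π y = z → 0 < f₂ y - c}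
  have hopen : ∀ {K : Set E} (_ : IsCompact K) {f : E → ℝ} (_ : Continuous f) (z : ι → ℝ),
      (∀ x ∈ K, π x = z → 0 < f x) → ∀ᶠ w in nhds z, ∀ x ∈ K, π x = w → 0 < f x := by
    intro K hK f hf z hz
    have hc : IsClosed (π '' (K ∩ {x | f x ≤ 0})) :=
      ((hK.inter_right (isClosed_le hf continuous_const)).image hπ).isClosed
    have hmem : z ∈ (π '' (K ∩ {x | f x ≤ 0}))ᶜ := by
      rintro ⟨x, ⟨hxK, hx⟩, hxz⟩
      exact absurd (hz x hxK hxz) (not_lt.2 hx)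
    filter_upwards [hc.isOpen_compl.mem_nhds hmem] with w hw x hxK hxw
    by_contra hlt
    exact hw ⟨x, ⟨hxK, not_lt.1 hlt⟩, hxw⟩
  obtain ⟨φ, hφ⟩ := exists_continuous_forall_mem_convex_of_local_const (t := t)
    (fun z => by
      refine Set.OrdConnected.convex ⟨?_⟩
      rintro c ⟨hc, -⟩ d ⟨-, hd⟩ e ⟨hce, hed⟩
      exact ⟨fun x hx hxz => by linarith [hc x hx hxz], fun y hy hyz => by linarith [hd y hy hyz]⟩)
    (fun z => by
      have hz : IsClosed {x | π x = z} := isClosed_eq hπ continuous_const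
      obtain ⟨c, hc₁, hc₂⟩ := exists_between_of_isCompact
        ((hK₁.inter_right hz).image (f := fun x => -f₁ x) hf₁.neg) ((hK₂.inter_right hz).image hf₂) (by
          rintro _ ⟨x, ⟨hx, hxz⟩, rfl⟩ _ ⟨y, ⟨hy, hyz⟩, rfl⟩
          have := h x hx y hy (hxz.trans hyz.symm)
          linarith)
      refine ⟨c, (hopen hK₁ (hf₁.add continuous_const) z fun x hx hxz => ?_).and
        (hopen hK₂ (hf₂.sub continuous_const) z fun y hy hyz => ?_)⟩
      · have := hc₁ _ ⟨x, ⟨hx, hxz⟩, rfl⟩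
        change 0 < f₁ x + c
        linarith
      · have := hc₂ _ ⟨y, ⟨hy, hyz⟩, rfl⟩
        change 0 < f₂ y - c
        linarith)
  -- Compactness turns strict positivity into uniform margins, which leave room for a
  -- Stone–Weierstrass approximation.
  obtain ⟨δ₁, hδ₁, h₁⟩ := hK₁.exists_forall_le' (f := fun x => f₁ x + φ (π x)) (a := 0)
    (by fun_prop) (fun x hx => (hφ (π x)).1 x hx rfl)
  obtain ⟨δ₂, hδ₂, h₂⟩ := hK₂.exists_forall_le' (f := fun x => f₂ x - φ (π x)) (a := 0)
    (by fun_prop) (fun x hx => (hφ (π x)).2 x hx rfl)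
  obtain ⟨P, hP⟩ := exists_mvPolynomial_near ((hK₁.image hπ).union (hK₂.image hπ)) φ.continuous
    (lt_min hδ₁ hδ₂)
  refine ⟨P, fun x hx => ?_, fun y hy => ?_⟩
  · have h3 := abs_lt.1 (hP (π x) (Or.inl ⟨x, hx, rfl⟩))
    have h4 := min_le_left δ₁ δ₂
    have h5 := h₁ x hx
    linarith
  · have h3 := abs_lt.1 (hP (π y) (Or.inr ⟨y, hy, rfl⟩))
    have h4 := min_le_right δ₁ δ₂
    have h5 := h₂ y hy
    linarith

theorem eval_eq_of_mem_supported {σ : Type*} {S : Set σ} {p : MvPolynomial σ ℝ}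
    (hp : p ∈ supported ℝ S) {x y : σ → ℝ} (h : ∀ i ∈ S, x i = y i) : eval x p = eval y p := by
  rw [supported_eq_range_rename] at hp
  obtain ⟨q, rfl⟩ := hp
  change eval x (rename _ q) = eval y (rename _ q)
  rw [eval_rename, eval_rename]
  congr 2
  exact funext fun i => h i i.2

theorem rename_mem_supported {σ : Type*} {J : Finset σ} (q : MvPolynomial J ℝ) :
    rename Subtype.val q ∈ supported ℝ (J : Set σ) := by
  rw [supported_eq_range_rename]
  exact ⟨q, rfl⟩

variable {n k : ℕ}

/-- Under the running intersection property, a sparse sum that is positive where all local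
constraints hold can be rewritten so that every summand is positive where its own local constraint
holds. -/
theorem exists_local_pos {I : Fin k → Finset (Fin n)} (hRIP : RIP I)
    {D : Fin k → Set (Fin n → ℝ)} (hD : ∀ l, IsClosed (D l))
    (hDI : ∀ l, ∀ x y : Fin n → ℝ, (∀ i ∈ I l, x i = y i) → x ∈ D l → y ∈ D l) (M : ℝ) (s : ℕ)
    (hs : s ≤ k) (f : Fin k → MvPolynomial (Fin n) ℝ)
    (hf : ∀ l, f l ∈ supported ℝ (I l : Set (Fin n)))
    (hpos : ∀ x ∈ Set.univ.pi (fun _ : Fin n => Set.Icc (-M) M), (∀ l : Fin k, l.val < s → x ∈ D l) →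
      0 < ∑ l : Fin k with l.val < s, eval x (f l)) :
    ∃ f' : Fin k → MvPolynomial (Fin n) ℝ, (∀ l, f' l ∈ supported ℝ (I l : Set (Fin n))) ∧
      ∑ l : Fin k with l.val < s, f' l = ∑ l : Fin k with l.val < s, f l ∧
      ∀ l : Fin k, l.val < s → ∀ x ∈ Set.univ.pi (fun _ : Fin n => Set.Icc (-M) M), x ∈ D l →
        0 < eval x (f' l) := by
  classical
  induction s generalizing f with
  | zero => exact ⟨f, hf, rfl, fun l hl => absurd hl (Nat.not_lt_zero _)⟩
  | succ s ih =>
    set B := Set.univ.pi (fun _ : Fin n => Set.Icc (-M) M) with hBdef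
    let t : Fin k := ⟨s, hs⟩
    have htl : ∀ l : Fin k, l.val < s + 1 ↔ l = t ∨ l.val < s := fun l => by
      rw [Fin.ext_iff]; change _ ↔ l.val = s ∨ _; omega
    have hfil : (Finset.univ.filter fun l : Fin k => l.val < s + 1) =
        insert t (Finset.univ.filter fun l : Fin k => l.val < s) := by
      ext l; simp [htl]
    have htn : t ∉ Finset.univ.filter fun l : Fin k => l.val < s := by simp [t]
    simp only [hfil, Finset.sum_insert htn] at hpos ⊢
    -- The first member has no predecessor, so the running intersection property says nothing about
    -- it.
    rcases Nat.eq_zero_or_pos s with rfl | hs0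
    · refine ⟨f, hf, rfl, fun l hl x hx hxD => ?_⟩
      have hlt : l = t := by simpa using (htl l).1 hl
      rw [hlt] at hxD ⊢
      have := hpos x hx fun l' hl' => by
        have : l' = t := by simpa using (htl l').1 hl'
        rwa [this]
      simpa using this
    obtain ⟨j, hjt, hj⟩ := hRIP t hs0
    set V := (Finset.univ.filter fun l : Fin k => l < t).biUnion I with hV
    set J := V ∩ I t with hJ
    have hjs : j.val < s := hjt
    have hIV : ∀ l : Fin k, l.val < s → I l ⊆ V := fun l hl =>
      Finset.subset_biUnion_of_mem I (Finset.mem_filter.2 ⟨Finset.mem_univ _, hl⟩)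
    have hB : IsCompact B := isCompact_univ_pi fun _ => isCompact_Icc
    have hcl : IsClosed {x : Fin n → ℝ | ∀ l : Fin k, l.val < s → x ∈ D l} := by
      simp only [Set.ofPred_forall]
      exact isClosed_iInter fun l => isClosed_iInter fun _ => hD l
    obtain ⟨P, hP₁, hP₂⟩ := exists_mvPolynomial_separating
      (π := fun (x : Fin n → ℝ) (i : J) => x i) (by fun_prop)
      (hB.inter_right hcl) (hB.inter_right (hD t))
      (f₁ := fun x => ∑ l : Fin k with l.val < s, eval x (f l)) (f₂ := fun x => eval x (f t))
      (continuous_finsetSum _ fun l _ => MvPolynomial.continuous_eval _)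
      (MvPolynomial.continuous_eval _) (by
        rintro x ⟨hxB, hx⟩ y ⟨hyB, hy⟩ hxy
        have hxy' : ∀ i ∈ J, x i = y i := fun i hi => congrFun hxy ⟨i, hi⟩
        -- Since `x` and `y` agree on `J = V ∩ I t`, they glue to a point of the box meeting all the
        -- constraints.
        let w : Fin n → ℝ := fun i => if i ∈ V then x i else y i
        have hwx : ∀ i ∈ V, x i = w i := fun i hi => by simp [w, hi]
        have hwy : ∀ i ∈ I t, y i = w i := fun i hi => by
          by_cases hiV : i ∈ V
          · rw [← hwx i hiV, hxy' i (Finset.mem_inter.2 ⟨hiV, hi⟩)]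
          · simp [w, hiV]
        have hw := hpos w (fun i _ => by
            by_cases hiV : i ∈ V
            · simpa [w, hiV] using hxB i trivial
            · simpa [w, hiV] using hyB i trivial) (fun l hl => by
            rcases (htl l).1 hl with rfl | hl
            · exact hDI _ y w hwy hy
            · exact hDI _ x w (fun i hi => hwx i (hIV l hl hi)) (hx l hl))
        rw [eval_eq_of_mem_supported (hf t) hwy, add_comm]
        convert hw using 2
        refine Finset.sum_congr rfl fun l hl => ?_
        exact eval_eq_of_mem_supported (hf l)
          fun i hi => hwx i (hIV l (Finset.mem_filter.1 hl).2 hi))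
    set Φ : MvPolynomial (Fin n) ℝ := rename Subtype.val P with hΦ
    have hΦJ : Φ ∈ supported ℝ (J : Set (Fin n)) := rename_mem_supported P
    have hΦj : Φ ∈ supported ℝ (I j : Set (Fin n)) :=
      supported_mono (Finset.coe_subset.2 hj) hΦJ
    have hΦt : Φ ∈ supported ℝ (I t : Set (Fin n)) :=
      supported_mono (Finset.coe_subset.2 Finset.inter_subset_right) hΦJ
    have hev : ∀ x, eval x Φ = eval (fun i : J => x i) P := fun x => eval_rename _ _ _
    have hjmem : j ∈ Finset.univ.filter fun l : Fin k => l.val < s := by simpa using hjs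
    -- The correction `Φ` depends only on `J ⊆ I j`, so it can be added to the summand of `j` and
    -- subtracted from that of `t` without breaking sparsity.
    obtain ⟨f', hf', hsum, hf'pos⟩ := ih (Nat.le_of_succ_le hs)
      (fun l => f l + if l = j then Φ else 0)
      (fun l => by
        refine add_mem (hf l) ?_
        split_ifs with h
        · exact h ▸ hΦj
        · exact zero_mem _)
      (fun x hx hxD => by
        have := hP₁ x ⟨hx, hxD⟩
        rw [← map_sum, Finset.sum_add_distrib, Finset.sum_ite_eq' _ j, if_pos hjmem, map_add,
          map_sum, hev]
        exact this)
    rw [Finset.sum_add_distrib, Finset.sum_ite_eq' _ j, if_pos hjmem] at hsum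
    have hne : ∀ l : Fin k, l.val < s → l ≠ t := fun l hl h => by
      rw [h] at hl; exact lt_irrefl _ hl
    refine ⟨Function.update f' t (f t - Φ), fun l => ?_, ?_, fun l hl x hx hxD => ?_⟩
    · by_cases h : l = t
      · subst h
        rw [Function.update_self]
        exact sub_mem (hf _) hΦt
      · rw [Function.update_of_ne h]
        exact hf' l
    · rw [Function.update_self, Finset.sum_congr rfl fun l hl =>
        Function.update_of_ne (hne l (Finset.mem_filter.1 hl).2) _ _, hsum]
      ring
    · rcases (htl l).1 hl with rfl | hl
      · rw [Function.update_self, map_sub, hev]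
        exact hP₂ x ⟨hx, hxD⟩
      · rw [Function.update_of_ne (hne l hl)]
        exact hf'pos l hl x hx hxD

end Gluing

/-! ### Removing the constraints by high-power penalties. -/

section Penalty

/-- Subtracting high-power penalty terms makes a function that is positive on
`{x ∈ B | ∀ j, 0 ≤ g j x}` positive on the whole compact set `B`. -/
theorem exists_pow_penalty {E ι : Type*} [TopologicalSpace E] [Fintype ι] {B : Set E}
    (hB : IsCompact B) {p : E → ℝ} (hp : Continuous p) {g : ι → E → ℝ}
    (hg : ∀ j, Continuous (g j)) {U : ι → ℝ} (hU : ∀ j, 0 < U j) (hgU : ∀ x ∈ B, ∀ j, g j x ≤ U j)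
    (hpos : ∀ x ∈ B, (∀ j, 0 ≤ g j x) → 0 < p x) :
    ∃ N : ℕ, ∀ x ∈ B, 0 < p x - ∑ j, (1 - g j x / U j) ^ (2 * N) * g j x := by
  classical
  have hmono : ∀ x ∈ B, Monotone fun N : ℕ =>
      p x - ∑ j, (1 - g j x / U j) ^ (2 * N) * g j x := by
    intro x hx
    refine monotone_nat_of_le_succ fun N => sub_le_sub_left (Finset.sum_le_sum fun j _ => ?_) _
    have hs : g j x / U j ≤ 1 := (div_le_one (hU j)).2 (hgU x hx j)
    have hgs : g j x = g j x / U j * U j := (div_mul_cancel₀ _ (hU j).ne').symm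
    set r := g j x / U j
    rw [hgs, mul_add, mul_one, pow_add, mul_assoc]
    refine mul_le_mul_of_nonneg_left ?_ (Even.pow_nonneg (even_two_mul N) _)
    -- Here `r - (1 - r)² r = r² (2 - r)`, non-negative because `r ≤ 1`.
    have h1 : 0 ≤ r ^ 2 * (2 - r) * U j :=
      mul_nonneg (mul_nonneg (sq_nonneg r) (by linarith)) (hU j).le
    linear_combination h1
  have hterm : ∀ x ∈ B, ∀ j N, (1 - g j x / U j) ^ (2 * N) * g j x ≤ U j := by
    intro x hx j N
    rcases le_total (g j x) 0 with h | h
    · exact (mul_nonpos_of_nonneg_of_nonpos (Even.pow_nonneg (even_two_mul N) _) h).trans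
        (hU j).le
    · have hs : g j x / U j ≤ 1 := (div_le_one (hU j)).2 (hgU x hx j)
      have hs0 : 0 ≤ g j x / U j := div_nonneg h (hU j).le
      exact (mul_le_of_le_one_left h (pow_le_one₀ (by linarith) (by linarith))).trans (hgU x hx j)
  have hpt : ∀ x ∈ B, ∃ N : ℕ, 0 < p x - ∑ j, (1 - g j x / U j) ^ (2 * N) * g j x := by
    intro x hx
    by_cases h : ∀ j, 0 ≤ g j x
    · have hlim : Filter.Tendsto (fun N : ℕ => p x - ∑ j, (1 - g j x / U j) ^ (2 * N) * g j x)
          Filter.atTop (nhds (p x - ∑ _j : ι, 0)) := by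
        refine tendsto_const_nhds.sub (tendsto_finsetSum _ fun j _ => ?_)
        rcases (h j).eq_or_lt with h0 | h0
        · simp [← h0]
        · have hs : g j x / U j ≤ 1 := (div_le_one (hU j)).2 (hgU x hx j)
          have hs0 : 0 < g j x / U j := div_pos h0 (hU j)
          have := (tendsto_pow_atTop_nhds_zero_of_lt_one (r := (1 - g j x / U j) ^ 2)
            (sq_nonneg _) (pow_lt_one₀ (by linarith) (by linarith) two_ne_zero)).mul_const (g j x)
          simpa only [← pow_mul, zero_mul] using this
      rw [Finset.sum_const_zero, sub_zero] at hlim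
      exact (hlim.eventually_const_lt (hpos x hx h)).exists
    · push Not at h
      obtain ⟨i, hi⟩ := h
      have hs0 : g i x / U i < 0 := div_neg_of_neg_of_pos hi (hU i)
      -- A single violated constraint is enough: its term outgrows the other penalties, each at most
      -- `U j`.
      obtain ⟨N, hN⟩ := pow_unbounded_of_one_lt ((∑ j, U j - p x) / -g i x)
        (show 1 < (1 - g i x / U i) ^ 2 by nlinarith)
      refine ⟨N, ?_⟩
      rw [← pow_mul, div_lt_iff₀ (by linarith)] at hN
      have h1 := Finset.sum_le_sum fun j (_ : j ∈ Finset.univ.erase i) => hterm x hx j N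
      have h2 := Finset.add_sum_erase Finset.univ
        (fun j => (1 - g j x / U j) ^ (2 * N) * g j x) (Finset.mem_univ i)
      have h3 := Finset.add_sum_erase Finset.univ U (Finset.mem_univ i)
      have h4 := hU i
      linarith
  -- A Dini argument: by monotonicity in `N`, the largest exponent of a finite subcover works
  -- everywhere.
  obtain ⟨t, ht⟩ := hB.elim_finite_subcover
    (fun N : ℕ => {x | 0 < p x - ∑ j, (1 - g j x / U j) ^ (2 * N) * g j x})
    (fun N => isOpen_lt continuous_const (by fun_prop))
    (fun x hx => Set.mem_iUnion.2 (hpt x hx))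
  refine ⟨t.sup id, fun x hx => ?_⟩
  obtain ⟨N, hN, hxN⟩ := Set.mem_iUnion₂.1 (ht hx)
  exact lt_of_lt_of_le hxN (hmono x hx (Finset.le_sup (f := id) hN))

end Penalty

/-! ### Combining penalty, gluing and local representation. -/

section Assembly

variable {n k m : ℕ}

theorem norm_restr_le_iff (J : Finset (Fin n)) {r : ℝ} (hr : 0 ≤ r) (x : Fin n → ℝ) :
    ‖restr J x‖ ≤ r ↔ ∑ i ∈ J, x i ^ 2 ≤ r ^ 2 := by
  rw [← sq_le_sq₀ (norm_nonneg _) hr, EuclideanSpace.real_norm_sq_eq,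
    ← Finset.sum_coe_sort J]
  rfl

theorem abs_le_of_sum_sq_le {ι : Type*} {J : Finset ι} {r : ℝ} (hr : 0 ≤ r) {x : ι → ℝ}
    (h : ∑ i ∈ J, x i ^ 2 ≤ r ^ 2) {i : ι} (hi : i ∈ J) : |x i| ≤ r :=
  abs_le_of_sq_le_sq ((Finset.single_le_sum (fun j _ => sq_nonneg (x j)) hi).trans h) hr

theorem extend_mem_supported (J : Finset (Fin n)) (q : MvPolynomial J ℝ) :
    extend J q ∈ supported ℝ (J : Set (Fin n)) :=
  rename_mem_supported q

theorem eval_extend (J : Finset (Fin n)) (q : MvPolynomial J ℝ) (x : Fin n → ℝ) :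
    eval x (extend J q) = eval (fun i : J => x i) q :=
  eval_rename _ _ _

/-- The univariate penalty polynomial `(t / c)^(2N)`. -/
noncomputable def penalty (c : ℝ) (N : ℕ) : MvPolynomial Unit ℝ :=
  C ((1 / c) ^ (2 * N)) * X () ^ (2 * N)

theorem penalty_mem_evenPos (c : ℝ) (N : ℕ) : penalty c N ∈ evenPos Unit :=
  mul_mem (C_mem_evenPos (Even.pow_nonneg (even_two_mul N) _)) (X_pow_mem_evenPos _ _)

theorem eval_substUni_penalty {c : ℝ} (hc : 0 < c) (N : ℕ) (h : MvPolynomial (Fin n) ℝ)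
    (x : Fin n → ℝ) :
    eval x (substUni (penalty c N) (C c - h)) = (1 - eval x h / c) ^ (2 * N) := by
  have : 1 - eval x h / c = 1 / c * (c - eval x h) := by field_simp
  rw [this, mul_pow]
  simp [substUni, penalty]

theorem substUni_mem_supported {S : Set (Fin n)} (ρ : MvPolynomial Unit ℝ)
    {h : MvPolynomial (Fin n) ℝ} (hh : h ∈ supported ℝ S) : substUni ρ h ∈ supported ℝ S := by
  rw [substUni]
  have hval : aeval (fun _ : Unit => h) ρ =
      (supported ℝ S).val (aeval (fun _ : Unit => (⟨h, hh⟩ : supported ℝ S)) ρ) :=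
    (comp_aeval_apply (fun _ : Unit => (⟨h, hh⟩ : supported ℝ S)) (supported ℝ S).val ρ).symm
  rw [hval]
  exact Subtype.property _

/-- A local summand positive on its ball is represented by even polynomials with nonnegative
coefficients in the ball data. -/
theorem exists_substBall_eq (J : Finset (Fin n)) {r M : ℝ} (hr : 0 < r) (hrM : r ≤ M)
    {f : MvPolynomial (Fin n) ℝ} (hf : f ∈ supported ℝ (J : Set (Fin n)))
    (hpos : ∀ x ∈ Set.univ.pi (fun _ : Fin n => Set.Icc (-M) M), ∑ i ∈ J, x i ^ 2 ≤ r ^ 2 →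
      0 < eval x f) :
    ∃ a ∈ evenPos (J ⊕ J ⊕ Unit), ∃ b ∈ evenPos (J ⊕ J ⊕ Unit),
      f = substBall J r (a + b * X (Sum.inr (Sum.inr ()))) := by
  classical
  rw [supported_eq_range_rename] at hf
  obtain ⟨h, rfl⟩ := hf
  obtain ⟨a, ha, b, hb, hab⟩ := mem_ballPreprime_of_pos (τ := J) hr (q := h) (by
    intro y hy
    -- Padding by zero keeps the point in the box.
    let x : Fin n → ℝ := fun i => if hi : i ∈ J then y ⟨i, hi⟩ else 0
    have hxy : ∀ i : J, x i = y i := fun i => by simp [x]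
    have hxs : ∑ i ∈ J, x i ^ 2 ≤ r ^ 2 := by
      rw [← Finset.sum_coe_sort J]
      simpa only [hxy] using hy
    have := hpos x (fun i _ => by
      by_cases hi : i ∈ J
      · exact abs_le.1 ((abs_le_of_sum_sq_le hr.le hxs hi).trans hrM)
      · simpa [x, hi] using hr.le.trans hrM) hxs
    change 0 < eval x (extend J h) at this
    rw [eval_extend] at this
    simpa only [hxy] using this)
  exact ⟨a, ha, b, hb, by rw [substBall_eq, ← hab]; rfl⟩

theorem exists_even_representation
    (I : Fin k → Finset (Fin n)) (hcover : IsCover I) (hRIP : RIP I)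
    (R : Fin k → ℝ) (hR : ∀ l, 0 < R l) (ι : Fin m → Fin k)
    (g : (j : Fin m) → MvPolynomial (I (ι j)) ℝ)
    (U : Fin m → ℝ) (hU : ∀ j, 0 < U j)
    (hgU : ∀ j, ∀ y : EuclideanSpace ℝ (I (ι j)), ‖y‖ ≤ R (ι j) → eval y.ofLp (g j) ≤ U j)
    (p : MvPolynomial (Fin n) ℝ) (hsparse : IsSparse I p)
    (hpos : ∀ x ∈ sparseBall I R,
      (∀ j, 0 ≤ eval (restr (I (ι j)) x).ofLp (g j)) → 0 < eval x p) :
    ∃ (a b : (l : Fin k) → MvPolynomial (I l ⊕ I l ⊕ Unit) ℝ) (ρ : Fin m → MvPolynomial Unit ℝ),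
      (∀ l, a l ∈ evenPos _ ∧ b l ∈ evenPos _) ∧ (∀ j, ρ j ∈ evenPos Unit) ∧
      p = ∑ l, substBall (I l) (R l) (a l + b l * X (Sum.inr (Sum.inr ()))) +
        ∑ j, substUni (ρ j) (C (U j) - extend (I (ι j)) (g j)) * extend (I (ι j)) (g j) := by
  classical
  obtain ⟨q, hq⟩ := hsparse
  have hRM : ∀ l, R l ≤ ∑ l, R l := fun l =>
    Finset.single_le_sum (fun l _ => (hR l).le) (Finset.mem_univ l)
  set M := ∑ l, R l
  set D : Fin k → Set (Fin n → ℝ) := fun l => {x | ∑ i ∈ I l, x i ^ 2 ≤ R l ^ 2} with hDdef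
  have hD : ∀ l, IsClosed (D l) := fun l => isClosed_le (by fun_prop) continuous_const
  have hball : ∀ x, x ∈ sparseBall I R ↔ ∀ l, x ∈ D l := fun x =>
    forall_congr' fun l => norm_restr_le_iff (I l) (hR l).le x
  have hcompact : IsCompact (sparseBall I R) := by
    have hcl : IsClosed (sparseBall I R) := by
      rw [show sparseBall I R = ⋂ l, D l by ext x; rw [hball, Set.mem_iInter]]
      exact isClosed_iInter hD
    refine IsCompact.of_isClosed_subset
      (isCompact_univ_pi fun _ : Fin n => isCompact_Icc (a := -M) (b := M)) hcl fun x hx i _ => ?_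
    obtain ⟨l, -, hl⟩ := Finset.mem_biUnion.1 (hcover ▸ Finset.mem_univ i : i ∈ _)
    exact abs_le.1 ((abs_le_of_sum_sq_le (hR l).le ((hball x).1 hx l) hl).trans (hRM l))
  obtain ⟨N, hN⟩ := exists_pow_penalty hcompact (MvPolynomial.continuous_eval p)
    (g := fun j x => eval x (extend (I (ι j)) (g j)))
    (fun j => MvPolynomial.continuous_eval _) hU
    (fun x hx j => by
      rw [eval_extend]; exact hgU j (restr (I (ι j)) x) (hx (ι j)))
    (fun x hx hgx => hpos x hx fun j => by
      have := hgx j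
      rwa [eval_extend] at this)
  set pen : Fin m → MvPolynomial (Fin n) ℝ := fun j =>
    substUni (penalty (U j) N) (C (U j) - extend (I (ι j)) (g j)) * extend (I (ι j)) (g j)
    with hpen
  have hpen_supp : ∀ j, pen j ∈ supported ℝ (I (ι j) : Set (Fin n)) := fun j =>
    mul_mem (substUni_mem_supported _ (sub_mem (Subalgebra.algebraMap_mem _ (U j))
      (extend_mem_supported _ _))) (extend_mem_supported _ _)
  -- Each penalty is charged to the member `ι j` whose variables it uses.
  have hsum : ∑ l, (extend (I l) (q l) - ∑ j with ι j = l, pen j) = p - ∑ j, pen j := by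
    rw [Finset.sum_sub_distrib, Finset.sum_fiberwise, hq]
  have hfil : (Finset.univ.filter fun l : Fin k => l.val < k) = Finset.univ := by simp
  obtain ⟨f, hf, hfsum, hfpos⟩ := exists_local_pos hRIP hD
    (fun l x y hxy hx => by
      change ∑ i ∈ I l, y i ^ 2 ≤ R l ^ 2
      rw [Finset.sum_congr rfl fun i hi => by rw [← hxy i hi]]
      exact hx) M k le_rfl
    (fun l => extend (I l) (q l) - ∑ j with ι j = l, pen j)
    (fun l => sub_mem (extend_mem_supported _ _) (sum_mem fun j hj =>
      (Finset.mem_filter.1 hj).2 ▸ hpen_supp j))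
    (fun x _ hx => by
      have := hN x ((hball x).2 fun l => hx l l.2)
      rw [hfil, ← map_sum, hsum, map_sub, map_sum]
      simpa only [hpen, map_mul, eval_substUni_penalty (hU _)] using this)
  rw [hfil, hsum] at hfsum
  choose a ha b hb hab using fun l => exists_substBall_eq (I l) (hR l) (hRM l) (hf l)
    (hfpos l l.2)
  refine ⟨a, b, fun j => penalty (U j) N, fun l => ⟨ha l, hb l⟩,
    fun j => penalty_mem_evenPos _ _, ?_⟩
  rw [← Finset.sum_congr rfl fun l _ => hab l, hfsum]
  simp [hpen]

end Assembly

end SparsePositivstellensatz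

theorem corollary4p2 {n k m : ℕ} (hk : 0 < k)
    (I : Fin k → Finset (Fin n))
    (hcover : SparsePositivstellensatz.IsCover I)
    (hRIP : SparsePositivstellensatz.RIP I)
    (R : Fin k → ℝ) (hR : ∀ l, 0 < R l)
    (ι : Fin m → Fin k)
    (g : (j : Fin m) → MvPolynomial (I (ι j)) ℝ)
    (U : Fin m → ℝ) (hU : ∀ j, 0 < U j)
    (hgU : ∀ j, ∀ y : EuclideanSpace ℝ (I (ι j)), ‖y‖ ≤ R (ι j) →
      MvPolynomial.eval y.ofLp (g j) ≤ U j)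
    (p : MvPolynomial (Fin n) ℝ)
    (hsparse : SparsePositivstellensatz.IsSparse I p)
    (hpos : ∀ x ∈ SparsePositivstellensatz.sparseBall I R,
      (∀ j, 0 ≤ MvPolynomial.eval (SparsePositivstellensatz.restr (I (ι j)) x).ofLp (g j)) →
        0 < MvPolynomial.eval x p) :
    (∀ K : (σ : Type) → Set (MvPolynomial σ ℝ),
      (K = SparsePositivstellensatz.SONC ∨ K = SparsePositivstellensatz.SDSOS ∨
        K = SparsePositivstellensatz.DSOS ∨ K = SparsePositivstellensatz.SAGE) →
      ∃ (α₀ α₁ : (l : Fin k) → MvPolynomial (I l ⊕ I l ⊕ Unit) ℝ)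
        (ρ : Fin m → MvPolynomial Unit ℝ),
        (∀ l, α₀ l ∈ K (I l ⊕ I l ⊕ Unit) ∧ α₁ l ∈ K (I l ⊕ I l ⊕ Unit)) ∧
        (∀ j, ρ j ∈ K Unit) ∧
        p = ∑ l, (SparsePositivstellensatz.substBall (I l) (R l) (α₀ l) +
              SparsePositivstellensatz.substBall (I l) (R l) (α₁ l) *
                SparsePositivstellensatz.ballPoly (I l) (R l)) +
            ∑ j, SparsePositivstellensatz.substUni (ρ j)
                (MvPolynomial.C (U j) - SparsePositivstellensatz.extend (I (ι j)) (g j)) *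
              SparsePositivstellensatz.extend (I (ι j)) (g j)) ∧
    (∃ (α : (l : Fin k) → MvPolynomial (I l ⊕ I l ⊕ Unit) ℝ)
        (ρ : Fin m → MvPolynomial Unit ℝ),
        (∀ l, α l ∈ SparsePositivstellensatz.SAGE (I l ⊕ I l ⊕ Unit)) ∧
        (∀ j, ρ j ∈ SparsePositivstellensatz.SAGE Unit) ∧
        p = ∑ l, SparsePositivstellensatz.substBall (I l) (R l) (α l) +
            ∑ j, SparsePositivstellensatz.substUni (ρ j)
                (MvPolynomial.C (U j) - SparsePositivstellensatz.extend (I (ι j)) (g j)) *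
              SparsePositivstellensatz.extend (I (ι j)) (g j)) := by
  open SparsePositivstellensatz in
  obtain ⟨a, b, ρ, hab, hρ, hp⟩ :=
    exists_even_representation I hcover hRIP R hR ι g U hU hgU p hsparse hpos
  -- For the second claim the SAGE witness is `a l + b l * u` itself, read off from `hp`.
  refine ⟨fun K hK => ?_, _, ρ, fun l => add_X_mul_mem_SAGE (hab l).1 (hab l).2 _,
    fun j => evenPos_subset_SAGE (hρ j), hp⟩
  have hKe : ∀ σ : Type, (evenPos σ : Set (MvPolynomial σ ℝ)) ⊆ K σ := by
    intro σ
    rcases hK with rfl | rfl | rfl | rfl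
    · exact evenPos_subset_SONC
    · exact evenPos_subset_DSOS.trans DSOS_subset_SDSOS
    · exact evenPos_subset_DSOS
    · exact evenPos_subset_SAGE
  refine ⟨a, b, ρ, fun l => ⟨hKe _ (hab l).1, hKe _ (hab l).2⟩, fun j => hKe _ (hρ j), ?_⟩
  simpa only [substBall_add_mul_X] using hp
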